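/- Let $\vartheta_3(z,q)=\sum_{n\in\mathbb{Z}}q^{n^2}e^{2inz}$, for $|q|<1$, be the Jacobi theta function. For every $\gamma>0$ the series defining $\vartheta_3(0,e^{-\gamma})$ converges absolutely and its sum is real. For $\gamma\ge\gamma_0>0$, \[ \vartheta_3(0,e^{-\gamma})-1\le e^{\gamma_0}\left(\vartheta_3(0,e^{-\gamma_0})-1\right)e^{-\gamma}. \] Moreover, \[ \vartheta_3(0,e^{-\gamma})-1\le c_\pi\,e^{-\gamma}\quad\text{for }\gamma\ge\pi, \] and \[ \sqrt{\frac{\pi}{\gamma}}<\vartheta_3(0,e^{-\gamma})\le\sqrt{\frac{\pi}{\gamma}}\left(1+c_\pi\,e^{-\pi^2/\gamma}\right)\quad\text{for }0<\gamma\le\pi, \] where \[ c_\pi=e^{\pi}\left(\frac{\sqrt[4]{\pi}}{\Gamma(3/4)}-1\right)<2.002. \] -/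

import Mathlib

/-- The `n`-th term `q ^ (n ^ 2) * e ^ (2 i n z)` of the series of the third Jacobi theta function
(`n ^ 2` is a non-negative integer exponent). -/
noncomputable def jacobiTheta3Term (z q : ℂ) (n : ℤ) : ℂ :=
  q ^ (n ^ 2) * Complex.exp (2 * Complex.I * (n : ℂ) * z)

/-- The Jacobi theta function `ϑ₃(z, q) = ∑_{n ∈ ℤ} q ^ (n ^ 2) e ^ (2 i n z)`, in terms of the
nome `q`, where `‖q‖ < 1`. -/
noncomputable def jacobiTheta3 (z q : ℂ) : ℂ :=
  ∑' n : ℤ, jacobiTheta3Term z q n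

/-- The number `ϑ₃(0, e ^ (-γ))`, as a real number. -/
noncomputable def theta3Zero (γ : ℝ) : ℝ :=
  (jacobiTheta3 0 ((Real.exp (-γ) : ℝ) : ℂ)).re

/-- The constant `c_π = e ^ π (π ^ (1/4) / Γ(3/4) - 1)`. -/
noncomputable def thetaConstPi : ℝ :=
  Real.exp Real.pi * (Real.pi ^ ((1 : ℝ) / 4) / Real.Gamma (3 / 4) - 1)

/-!
Write `ϑ₃(γ) = ∑ e ^ (-γ n²)` (`realTheta`) and `ϑ₄(γ) = ∑ (-1) ^ n e ^ (-γ n²)` (`realThetaAlt`).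

For `n ≠ 0` the quantity `e ^ (γ - γ n²)` is non-increasing in `γ`, so `e ^ γ (ϑ₃(γ) - 1)` is
non-increasing (`realTheta_sub_one_le`). This gives the bounds for large `γ`, and the functional
equation `ϑ₃(γ) = √(π / γ) ϑ₃(π² / γ)` (`realTheta_eq_sqrt_mul`) carries them over to `γ ≤ π`.
The constant comes from `γ₀ = π`, so all that remains is the value
`ϑ₃(π) = π ^ (1/4) / Γ(3/4)` (`realTheta_pi`).

This value is obtained from Gauss's theory of the arithmetic-geometric mean. Rearranging double
series over `ℤ²` gives `ϑ₃(γ)² + ϑ₄(γ)² = 2 ϑ₃(2γ)²` and `ϑ₃(γ) ϑ₄(γ) = ϑ₄(2γ)²`: the pair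
`(ϑ₃², ϑ₄²)` at `2γ` is the pair of arithmetic and geometric means of the same pair at `γ`. The
integral `∫₀^∞ dx / √((x² + a²) (x² + b²))` (`agmIntegral`) is invariant under such a step
(`agmIntegral_half_add_sqrt_mul`), and both theta functions tend to `1` as `γ → ∞`; hence the
integral at `(ϑ₃(γ)², ϑ₄(γ)²)` equals `π / 2` (`agmIntegral_theta`). At `γ = π` the functional
equation and the doubling identities force `ϑ₃⁴ = 2 ϑ₄⁴` (`realTheta_pi_pow_four`), so the integral
is a multiple of its lemniscatic value at `(√2, 1)`, which is a quarter of the Beta value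
`B(1/4, 1/2)` (`agmIntegral_sqrt_two_one`).
-/

/-! ### Real theta series -/

/-- The theta series `∑ e ^ (-γ n²)` over `n ∈ ℤ`, as a real sum; this is `ϑ₃(0, e ^ (-γ))`. -/
noncomputable def realTheta (γ : ℝ) : ℝ := ∑' n : ℤ, Real.exp (-γ * (n : ℝ) ^ 2)

/-- The alternating theta series `∑ (-1) ^ n e ^ (-γ n²)` over `n ∈ ℤ`; this is
`ϑ₄(0, e ^ (-γ))`. -/
noncomputable def realThetaAlt (γ : ℝ) : ℝ :=
  ∑' n : ℤ, (-1 : ℝ) ^ n * Real.exp (-γ * (n : ℝ) ^ 2)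

lemma summable_exp_neg_mul_int_sq {γ : ℝ} (hγ : 0 < γ) :
    Summable fun n : ℤ => Real.exp (-γ * (n : ℝ) ^ 2) := by
  have key : Summable fun n : ℕ => Real.exp (-γ * (n : ℝ) ^ 2) := by
    refine Summable.of_nonneg_of_le (fun n => (Real.exp_pos _).le) (fun n => ?_)
      (Real.summable_exp_nat_mul_iff.mpr (neg_neg_of_pos hγ))
    apply Real.exp_le_exp.mpr
    have h : (n : ℝ) ≤ (n : ℝ) ^ 2 := by exact_mod_cast Nat.le_self_pow two_ne_zero n
    nlinarith
  exact Summable.of_nat_of_neg (by simpa using key) (by simpa using key)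

lemma norm_neg_one_zpow_mul_exp (γ : ℝ) (n : ℤ) :
    ‖(-1 : ℝ) ^ n * Real.exp (-γ * (n : ℝ) ^ 2)‖ = Real.exp (-γ * (n : ℝ) ^ 2) := by
  rw [norm_mul, norm_zpow, norm_neg, norm_one, one_zpow, one_mul, Real.norm_eq_abs, Real.abs_exp]

lemma summable_norm_neg_one_zpow_mul_exp {γ : ℝ} (hγ : 0 < γ) :
    Summable fun n : ℤ => ‖(-1 : ℝ) ^ n * Real.exp (-γ * (n : ℝ) ^ 2)‖ := by
  simpa only [norm_neg_one_zpow_mul_exp] using summable_exp_neg_mul_int_sq hγ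

lemma jacobiTheta3Term_zero_exp (γ : ℝ) (n : ℤ) :
    jacobiTheta3Term 0 ((Real.exp (-γ) : ℝ) : ℂ) n = ((Real.exp (-γ * (n : ℝ) ^ 2) : ℝ) : ℂ) := by
  simp only [jacobiTheta3Term, mul_zero, Complex.exp_zero, mul_one]
  rw [← Complex.ofReal_zpow, Real.exp_mul, ← Int.cast_pow, Real.rpow_intCast]

lemma jacobiTheta3_zero_exp (γ : ℝ) :
    jacobiTheta3 0 ((Real.exp (-γ) : ℝ) : ℂ) = ((realTheta γ : ℝ) : ℂ) := by
  simp only [jacobiTheta3, jacobiTheta3Term_zero_exp, realTheta, Complex.ofReal_tsum]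

lemma theta3Zero_eq_realTheta (γ : ℝ) : theta3Zero γ = realTheta γ := by
  rw [theta3Zero, jacobiTheta3_zero_exp, Complex.ofReal_re]

/-- Poisson summation for the Gaussian, in the normalisation of `realTheta`. -/
lemma realTheta_eq_sqrt_mul {γ : ℝ} (hγ : 0 < γ) :
    realTheta γ = Real.sqrt (Real.pi / γ) * realTheta (Real.pi ^ 2 / γ) := by
  have hpi := Real.pi_pos
  have h := Real.tsum_exp_neg_mul_int_sq (div_pos hγ hpi)
  have e1 : -Real.pi * (γ / Real.pi) = -γ := by field_simp
  have e2 : -Real.pi / (γ / Real.pi) = -(Real.pi ^ 2 / γ) := by field_simp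
  rw [e1, e2, ← Real.sqrt_eq_rpow, one_div, ← Real.sqrt_inv, inv_div] at h
  exact h

lemma realTheta_eq_one_add_tsum_ite {γ : ℝ} (hγ : 0 < γ) :
    realTheta γ = 1 + ∑' n : ℤ, if n = 0 then 0 else Real.exp (-γ * (n : ℝ) ^ 2) := by
  simpa [realTheta] using (summable_exp_neg_mul_int_sq hγ).tsum_eq_add_tsum_ite (0 : ℤ)

lemma summable_ite_exp_neg_mul_int_sq {γ : ℝ} (hγ : 0 < γ) :
    Summable fun n : ℤ => if n = 0 then 0 else Real.exp (-γ * (n : ℝ) ^ 2) := by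
  refine Summable.of_nonneg_of_le (fun n => ?_) (fun n => ?_) (summable_exp_neg_mul_int_sq hγ)
  · split_ifs <;> positivity
  · split_ifs
    · positivity
    · exact le_rfl

/-- Termwise, `e ^ (γ - γ n²)` is non-increasing in `γ` for every `n ≠ 0`. -/
lemma realTheta_sub_one_le {γ₀ γ : ℝ} (h₀ : 0 < γ₀) (h : γ₀ ≤ γ) :
    realTheta γ - 1 ≤ Real.exp γ₀ * (realTheta γ₀ - 1) * Real.exp (-γ) := by
  rw [realTheta_eq_one_add_tsum_ite h₀, realTheta_eq_one_add_tsum_ite (h₀.trans_le h),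
    add_sub_cancel_left, add_sub_cancel_left, ← tsum_mul_left, ← tsum_mul_right]
  refine (summable_ite_exp_neg_mul_int_sq (h₀.trans_le h)).tsum_le_tsum (fun n => ?_)
    (((summable_ite_exp_neg_mul_int_sq h₀).mul_left _).mul_right _)
  split_ifs with hn
  · simp
  · rw [← Real.exp_add, ← Real.exp_add]
    apply Real.exp_le_exp.mpr
    have h1 : (1 : ℝ) ≤ (n : ℝ) ^ 2 := by
      exact_mod_cast (one_le_sq_iff_one_le_abs n).mpr (Int.one_le_abs hn)
    nlinarith

lemma one_lt_realTheta {γ : ℝ} (hγ : 0 < γ) : 1 < realTheta γ := by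
  rw [realTheta_eq_one_add_tsum_ite hγ]
  have := (summable_ite_exp_neg_mul_int_sq hγ).tsum_pos (fun n => by split_ifs <;> positivity) 1
    (by simp [Real.exp_pos])
  linarith

lemma tendsto_realTheta_atTop : Filter.Tendsto realTheta Filter.atTop (nhds 1) := by
  have h : Filter.Tendsto (fun γ => 1 + Real.exp 1 * (realTheta 1 - 1) * Real.exp (-γ))
      Filter.atTop (nhds 1) := by
    simpa using (Real.tendsto_exp_neg_atTop_nhds_zero.const_mul
      (Real.exp 1 * (realTheta 1 - 1))).const_add 1
  refine tendsto_of_tendsto_of_tendsto_of_le_of_le' tendsto_const_nhds h ?_ ?_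
  · filter_upwards [Filter.eventually_gt_atTop 0] with γ hγ using (one_lt_realTheta hγ).le
  · filter_upwards [Filter.eventually_ge_atTop 1] with γ hγ
    linarith [realTheta_sub_one_le one_pos hγ]

lemma abs_realThetaAlt_le {γ : ℝ} (hγ : 0 < γ) : |realThetaAlt γ| ≤ realTheta γ := by
  have h := norm_tsum_le_tsum_norm (summable_norm_neg_one_zpow_mul_exp hγ)
  simp only [norm_neg_one_zpow_mul_exp] at h
  exact h

lemma two_sub_realTheta_le_realThetaAlt {γ : ℝ} (hγ : 0 < γ) :
    2 - realTheta γ ≤ realThetaAlt γ := by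
  have ha := (summable_norm_neg_one_zpow_mul_exp hγ).of_norm
  have h : realThetaAlt γ = 1 + ∑' n : ℤ, if n = 0 then 0 else
      (-1 : ℝ) ^ n * Real.exp (-γ * (n : ℝ) ^ 2) := by
    simpa [realThetaAlt] using ha.tsum_eq_add_tsum_ite (0 : ℤ)
  have habs : ∀ n : ℤ, ‖if n = 0 then 0 else (-1 : ℝ) ^ n * Real.exp (-γ * (n : ℝ) ^ 2)‖ =
      if n = 0 then 0 else Real.exp (-γ * (n : ℝ) ^ 2) := by
    intro n
    split_ifs
    · simp
    · exact norm_neg_one_zpow_mul_exp γ n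
  have h2 := norm_tsum_le_tsum_norm (f := fun n : ℤ => if n = 0 then 0 else
    (-1 : ℝ) ^ n * Real.exp (-γ * (n : ℝ) ^ 2))
    (by simpa only [habs] using summable_ite_exp_neg_mul_int_sq hγ)
  simp only [habs] at h2
  rw [h, realTheta_eq_one_add_tsum_ite hγ]
  have := neg_le_of_abs_le h2
  linarith

lemma tendsto_realThetaAlt_atTop : Filter.Tendsto realThetaAlt Filter.atTop (nhds 1) := by
  have h : Filter.Tendsto (fun γ => 2 - realTheta γ) Filter.atTop (nhds 1) := by
    have := tendsto_realTheta_atTop.const_sub 2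
    norm_num at this
    exact this
  refine tendsto_of_tendsto_of_tendsto_of_le_of_le' h tendsto_realTheta_atTop ?_ ?_
  · filter_upwards [Filter.eventually_gt_atTop 0] with γ hγ
      using two_sub_realTheta_le_realThetaAlt hγ
  · filter_upwards [Filter.eventually_gt_atTop 0] with γ hγ
      using (le_abs_self _).trans (abs_realThetaAlt_le hγ)

/-! ### Doubling identities -/

/-- A sum over `ℤ²` whose terms vanish where `m + n` is odd may be taken over the index-two
sublattice, parametrised by `(a, b) ↦ (a + b, a - b)`. -/
lemma tsum_prod_eq_of_odd_eq_zero {f : ℤ × ℤ → ℝ} (hf : ∀ m n : ℤ, Odd (m + n) → f (m, n) = 0) :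
    ∑' p : ℤ × ℤ, f p = ∑' p : ℤ × ℤ, f (p.1 + p.2, p.1 - p.2) := by
  have hinj : Function.Injective fun p : ℤ × ℤ => (p.1 + p.2, p.1 - p.2) := by
    rintro ⟨a, b⟩ ⟨c, d⟩ h
    simp only [Prod.mk.injEq] at h ⊢
    omega
  refine (hinj.tsum_eq ?_).symm
  rintro ⟨m, n⟩ hmn
  have : Even (m + n) := by
    by_contra hodd
    exact hmn (hf m n (Int.not_even_iff_odd.mp hodd))
  obtain ⟨a, ha⟩ := this
  exact ⟨(a, m - a), by simp only [Prod.mk.injEq]; omega⟩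

lemma neg_one_zpow_sq (m : ℤ) : ((-1 : ℝ) ^ m) ^ 2 = 1 := by
  rcases Int.even_or_odd m with h | h
  · simp [h.neg_one_zpow]
  · simp [h.neg_one_zpow]

lemma realTheta_sq_add_realThetaAlt_sq {γ : ℝ} (hγ : 0 < γ) :
    realTheta γ ^ 2 + realThetaAlt γ ^ 2 = 2 * realTheta (2 * γ) ^ 2 := by
  have hs := (summable_exp_neg_mul_int_sq hγ).norm
  have hs2 := (summable_exp_neg_mul_int_sq (mul_pos two_pos hγ)).norm
  have ha := summable_norm_neg_one_zpow_mul_exp hγ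
  rw [sq, sq, sq, realTheta, realThetaAlt, realTheta, tsum_mul_tsum_of_summable_norm hs hs,
    tsum_mul_tsum_of_summable_norm ha ha, tsum_mul_tsum_of_summable_norm hs2 hs2,
    ← (summable_mul_of_summable_norm hs hs).tsum_add (summable_mul_of_summable_norm ha ha),
    ← tsum_mul_left, tsum_prod_eq_of_odd_eq_zero]
  · refine tsum_congr fun p => ?_
    have hsign : (-1 : ℝ) ^ (p.1 + p.2) * (-1 : ℝ) ^ (p.1 - p.2) = 1 := by
      rw [← zpow_add₀ (by norm_num)]
      exact Even.neg_one_zpow ⟨p.1, by ring⟩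
    rw [mul_mul_mul_comm, hsign, one_mul, ← Real.exp_add, ← Real.exp_add, ← two_mul]
    push_cast
    ring_nf
  · intro m n hmn
    have hsign : (-1 : ℝ) ^ m * (-1 : ℝ) ^ n = -1 := by
      rw [← zpow_add₀ (by norm_num), hmn.neg_one_zpow]
    rw [mul_mul_mul_comm, hsign]
    ring

lemma realTheta_mul_realThetaAlt {γ : ℝ} (hγ : 0 < γ) :
    realTheta γ * realThetaAlt γ = realThetaAlt (2 * γ) ^ 2 := by
  have hs := (summable_exp_neg_mul_int_sq hγ).norm
  have ha2 := summable_norm_neg_one_zpow_mul_exp (mul_pos two_pos hγ)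
  have ha := summable_norm_neg_one_zpow_mul_exp hγ
  -- The two orders of the factors are added, so that the terms with `m + n` odd cancel.
  have h : realTheta γ * realThetaAlt γ + realThetaAlt γ * realTheta γ =
      2 * realThetaAlt (2 * γ) ^ 2 := by
    rw [sq, realTheta, realThetaAlt, realThetaAlt, tsum_mul_tsum_of_summable_norm hs ha,
      tsum_mul_tsum_of_summable_norm ha hs, tsum_mul_tsum_of_summable_norm ha2 ha2,
      ← (summable_mul_of_summable_norm hs ha).tsum_add (summable_mul_of_summable_norm ha hs),
      ← tsum_mul_left, tsum_prod_eq_of_odd_eq_zero]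
    · refine tsum_congr fun p => ?_
      have hsign : (-1 : ℝ) ^ (p.1 - p.2) = (-1 : ℝ) ^ (p.1 + p.2) := by
        rw [show p.1 + p.2 = (p.1 - p.2) + 2 * p.2 by ring, zpow_add₀ (by norm_num),
          (even_two_mul p.2).neg_one_zpow, mul_one]
      have hexp : Real.exp (-γ * ((p.1 + p.2 : ℤ) : ℝ) ^ 2) *
          Real.exp (-γ * ((p.1 - p.2 : ℤ) : ℝ) ^ 2) =
          Real.exp (-(2 * γ) * (p.1 : ℝ) ^ 2) * Real.exp (-(2 * γ) * (p.2 : ℝ) ^ 2) := by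
        rw [← Real.exp_add, ← Real.exp_add]
        push_cast
        ring_nf
      rw [hsign, mul_mul_mul_comm ((-1 : ℝ) ^ p.1), ← zpow_add₀ (by norm_num), ← hexp]
      ring
    · intro m n hmn
      have hsign : (-1 : ℝ) ^ n = -(-1 : ℝ) ^ m := by
        have h1 : (-1 : ℝ) ^ m * (-1 : ℝ) ^ n = -1 := by
          rw [← zpow_add₀ (by norm_num), hmn.neg_one_zpow]
        linear_combination (-1 : ℝ) ^ m * h1 - (-1 : ℝ) ^ n * neg_one_zpow_sq m
      rw [hsign]
      ring
  linarith [mul_comm (realTheta γ) (realThetaAlt γ)]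

/-- At the fixed point `γ = π` of `γ ↦ π² / γ`, the doubling identities at `π / 2` and `π`
and the functional equation between `π / 2` and `2 π` determine `ϑ₄⁴ / ϑ₃⁴`. -/
lemma realTheta_pi_pow_four :
    realTheta Real.pi ^ 4 = 2 * realThetaAlt Real.pi ^ 4 := by
  have hpi := Real.pi_pos
  have hpi2 : 0 < Real.pi / 2 := by positivity
  have h1 := realTheta_sq_add_realThetaAlt_sq hpi
  have h2 := realTheta_sq_add_realThetaAlt_sq hpi2
  have h3 := realTheta_mul_realThetaAlt hpi2
  have h4 := realTheta_eq_sqrt_mul hpi2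
  have e1 : Real.pi / (Real.pi / 2) = 2 := by field_simp
  have e2 : Real.pi ^ 2 / (Real.pi / 2) = 2 * Real.pi := by field_simp
  rw [mul_div_cancel₀ _ two_ne_zero] at h2 h3
  rw [e1, e2] at h4
  have h5 : realTheta (Real.pi / 2) ^ 2 = 2 * realTheta (2 * Real.pi) ^ 2 := by
    rw [h4, mul_pow, Real.sq_sqrt zero_le_two]
  have h6 : realTheta (Real.pi / 2) ^ 2 * realThetaAlt (Real.pi / 2) ^ 2 =
      realThetaAlt Real.pi ^ 4 := by
    rw [← mul_pow, h3]; ring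
  have h7 : realTheta (Real.pi / 2) ^ 2 = realTheta Real.pi ^ 2 + realThetaAlt Real.pi ^ 2 := by
    linarith
  have h8 : realThetaAlt (Real.pi / 2) ^ 2 = realTheta Real.pi ^ 2 - realThetaAlt Real.pi ^ 2 := by
    linarith
  rw [h7, h8] at h6
  linarith

/-! ### The complete elliptic integral and the arithmetic-geometric mean -/

/-- The complete elliptic integral of the first kind in its symmetric form
`∫₀^∞ dx / √((x² + a²) (x² + b²))`. -/
noncomputable def agmIntegral (a b : ℝ) : ℝ :=
  ∫ x in Set.Ioi (0 : ℝ), (Real.sqrt ((x ^ 2 + a ^ 2) * (x ^ 2 + b ^ 2)))⁻¹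

lemma integral_univ_eq_two_mul_agmIntegral (a b : ℝ) :
    ∫ x : ℝ, (Real.sqrt ((x ^ 2 + a ^ 2) * (x ^ 2 + b ^ 2)))⁻¹ = 2 * agmIntegral a b := by
  rw [agmIntegral, ← integral_comp_abs]
  simp only [sq_abs]

lemma image_half_sub_div_Ioi {c : ℝ} (hc : 0 < c) :
    (fun t : ℝ => (t - c / t) / 2) '' Set.Ioi 0 = Set.univ := by
  refine Set.eq_univ_of_forall fun x => ?_
  have hr : 0 < x ^ 2 + c := by positivity
  have hs := Real.sq_sqrt hr.le
  have hlt : |x| < Real.sqrt (x ^ 2 + c) := by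
    rw [← Real.sqrt_sq_eq_abs]
    exact Real.sqrt_lt_sqrt (sq_nonneg x) (by linarith)
  have hpos : 0 < x + Real.sqrt (x ^ 2 + c) := by linarith [neg_abs_le x]
  -- The positive root of `t² - 2 x t - c = 0`.
  refine ⟨x + Real.sqrt (x ^ 2 + c), hpos, ?_⟩
  simp only
  field_simp
  linear_combination hs

lemma injOn_half_sub_div_Ioi {c : ℝ} (hc : 0 < c) :
    Set.InjOn (fun t : ℝ => (t - c / t) / 2) (Set.Ioi 0) := by
  intro s hs t ht h
  have hs' : 0 < s := hs
  have ht' : 0 < t := ht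
  have h1 : s * t * (s - t) = -c * (s - t) := by
    simp only at h
    field_simp at h
    linear_combination h
  have h2 : (s - t) * (s * t + c) = 0 := by linear_combination h1
  rcases mul_eq_zero.mp h2 with h3 | h3
  · linarith
  · nlinarith [mul_pos hs' ht']

/-- Gauss's invariance of the elliptic integral under the arithmetic-geometric mean step, by the
substitution `x = (t - a b / t) / 2`, which maps `(0, ∞)` bijectively onto `ℝ`. -/
lemma agmIntegral_half_add_sqrt_mul {a b : ℝ} (ha : 0 < a) (hb : 0 < b) :
    agmIntegral ((a + b) / 2) (Real.sqrt (a * b)) = agmIntegral a b := by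
  have hab : 0 < a * b := mul_pos ha hb
  have hderiv : ∀ t ∈ Set.Ioi (0 : ℝ), HasDerivWithinAt (fun t : ℝ => (t - a * b / t) / 2)
      ((1 + a * b / t ^ 2) / 2) (Set.Ioi 0) t := by
    intro t ht
    have ht' : t ≠ 0 := ne_of_gt ht
    have h := ((hasDerivAt_id t).sub ((hasDerivAt_inv ht').const_mul (a * b))).div_const 2
    refine (h.congr_deriv ?_).hasDerivWithinAt
    field_simp
    ring
  have h := MeasureTheory.integral_image_eq_integral_abs_deriv_smul measurableSet_Ioi hderiv
    (injOn_half_sub_div_Ioi hab)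
    (fun x => (Real.sqrt ((x ^ 2 + ((a + b) / 2) ^ 2) * (x ^ 2 + Real.sqrt (a * b) ^ 2)))⁻¹)
  rw [image_half_sub_div_Ioi hab, MeasureTheory.setIntegral_univ,
    integral_univ_eq_two_mul_agmIntegral] at h
  have h2 : ∫ t in Set.Ioi (0 : ℝ), |(1 + a * b / t ^ 2) / 2| •
      (Real.sqrt ((((t - a * b / t) / 2) ^ 2 + ((a + b) / 2) ^ 2) *
        (((t - a * b / t) / 2) ^ 2 + Real.sqrt (a * b) ^ 2)))⁻¹ = 2 * agmIntegral a b := by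
    rw [agmIntegral, ← MeasureTheory.integral_const_mul]
    refine MeasureTheory.setIntegral_congr_fun measurableSet_Ioi fun t ht => ?_
    have ht' : 0 < t := ht
    have hP : 0 < (t ^ 2 + a ^ 2) * (t ^ 2 + b ^ 2) := by positivity
    have hfac : (((t - a * b / t) / 2) ^ 2 + ((a + b) / 2) ^ 2) *
        (((t - a * b / t) / 2) ^ 2 + Real.sqrt (a * b) ^ 2) =
        ((t ^ 2 + a * b) / (4 * t ^ 2)) ^ 2 * ((t ^ 2 + a ^ 2) * (t ^ 2 + b ^ 2)) := by
      rw [Real.sq_sqrt hab.le]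
      field_simp
      ring
    simp only [smul_eq_mul]
    rw [hfac, Real.sqrt_mul (sq_nonneg _), Real.sqrt_sq (by positivity), abs_of_pos (by positivity)]
    have := Real.sqrt_pos.mpr hP
    field_simp
    ring
  linarith

lemma agmIntegral_mul {k : ℝ} (hk : 0 < k) (a b : ℝ) :
    agmIntegral (k * a) (k * b) = k⁻¹ * agmIntegral a b := by
  have h := MeasureTheory.integral_comp_mul_left_Ioi
    (fun x : ℝ => (Real.sqrt ((x ^ 2 + (k * a) ^ 2) * (x ^ 2 + (k * b) ^ 2)))⁻¹) 0 hk
  have h2 : ∀ x : ℝ, (Real.sqrt (((k * x) ^ 2 + (k * a) ^ 2) * ((k * x) ^ 2 + (k * b) ^ 2)))⁻¹ =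
      (k ^ 2)⁻¹ * (Real.sqrt ((x ^ 2 + a ^ 2) * (x ^ 2 + b ^ 2)))⁻¹ := by
    intro x
    rw [show ((k * x) ^ 2 + (k * a) ^ 2) * ((k * x) ^ 2 + (k * b) ^ 2) =
      (k ^ 2) ^ 2 * ((x ^ 2 + a ^ 2) * (x ^ 2 + b ^ 2)) by ring,
      Real.sqrt_mul (by positivity), Real.sqrt_sq (by positivity), mul_inv]
  simp only [h2, mul_zero, MeasureTheory.integral_const_mul, smul_eq_mul] at h
  change (k ^ 2)⁻¹ * agmIntegral a b = k⁻¹ * agmIntegral (k * a) (k * b) at h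
  field_simp at h ⊢
  linarith

lemma integrableOn_inv_sq_add_sq {a : ℝ} (ha : 0 < a) :
    MeasureTheory.IntegrableOn (fun x : ℝ => (x ^ 2 + a ^ 2)⁻¹) (Set.Ioi 0) := by
  have h := (integrable_inv_one_add_sq.comp_div ha.ne').const_mul ((a ^ 2)⁻¹)
  refine (h.congr (Filter.Eventually.of_forall fun x => ?_)).integrableOn
  simp only
  field_simp
  ring

lemma integral_Ioi_inv_sq_add_sq {a : ℝ} (ha : 0 < a) :
    ∫ x in Set.Ioi (0 : ℝ), (x ^ 2 + a ^ 2)⁻¹ = Real.pi / (2 * a) := by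
  have h := MeasureTheory.integral_comp_mul_left_Ioi (fun x : ℝ => (x ^ 2 + a ^ 2)⁻¹) 0 ha
  have h2 : ∀ x : ℝ, ((a * x) ^ 2 + a ^ 2)⁻¹ = (a ^ 2)⁻¹ * (1 + x ^ 2)⁻¹ := by
    intro x
    rw [← mul_inv]
    ring_nf
  simp only [h2, mul_zero, MeasureTheory.integral_const_mul, smul_eq_mul,
    integral_Ioi_inv_one_add_sq, Real.arctan_zero, sub_zero] at h
  field_simp at h ⊢
  linarith

lemma sqrt_mul_bounds {u v : ℝ} (hv : 0 < v) (h : v ≤ u) :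
    u⁻¹ ≤ (Real.sqrt (u * v))⁻¹ ∧ (Real.sqrt (u * v))⁻¹ ≤ v⁻¹ := by
  have hu : 0 < u := hv.trans_le h
  constructor
  · apply inv_anti₀ (Real.sqrt_pos.mpr (mul_pos hu hv))
    exact Real.sqrt_le_iff.mpr ⟨hu.le, by nlinarith⟩
  · apply inv_anti₀ hv
    exact Real.le_sqrt_of_sq_le (by nlinarith)

lemma agmIntegral_bounds {a b : ℝ} (hb : 0 < b) (h : b ≤ a) :
    Real.pi / (2 * a) ≤ agmIntegral a b ∧ agmIntegral a b ≤ Real.pi / (2 * b) := by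
  have ha : 0 < a := hb.trans_le h
  have key : ∀ x : ℝ, _ := fun x => sqrt_mul_bounds (u := x ^ 2 + a ^ 2) (v := x ^ 2 + b ^ 2)
    (by positivity) (by gcongr)
  have hint : MeasureTheory.IntegrableOn
      (fun x : ℝ => (Real.sqrt ((x ^ 2 + a ^ 2) * (x ^ 2 + b ^ 2)))⁻¹) (Set.Ioi 0) := by
    refine (integrableOn_inv_sq_add_sq hb).mono' ?_ (Filter.Eventually.of_forall fun x => ?_)
    · exact Measurable.aestronglyMeasurable (by fun_prop)
    · rw [Real.norm_of_nonneg (by positivity)]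
      exact (key x).2
  rw [← integral_Ioi_inv_sq_add_sq ha, ← integral_Ioi_inv_sq_add_sq hb]
  exact ⟨MeasureTheory.setIntegral_mono (integrableOn_inv_sq_add_sq ha) hint fun x => (key x).1,
    MeasureTheory.setIntegral_mono hint (integrableOn_inv_sq_add_sq hb) fun x => (key x).2⟩

lemma beta_eq_setIntegral {α β : ℝ} (hα : 0 < α) (hβ : 0 < β) :
    ProbabilityTheory.beta α β =
      ∫ u in Set.Ioo (0 : ℝ) 1, u ^ (α - 1) * (1 - u) ^ (β - 1) := by
  have h : Complex.betaIntegral α β =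
      ((∫ u in Set.Ioo (0 : ℝ) 1, u ^ (α - 1) * (1 - u) ^ (β - 1) : ℝ) : ℂ) := by
    rw [Complex.betaIntegral, intervalIntegral.integral_of_le zero_le_one,
      MeasureTheory.integral_Ioc_eq_integral_Ioo, ← integral_complex_ofReal]
    refine MeasureTheory.setIntegral_congr_fun measurableSet_Ioo fun u hu => ?_
    rw [Complex.ofReal_mul, Complex.ofReal_cpow hu.1.le,
      Complex.ofReal_cpow (sub_nonneg.mpr hu.2.le)]
    push_cast
    rfl
  rw [ProbabilityTheory.beta_eq_betaIntegralReal α β hα hβ, h, Complex.ofReal_re]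

/-- The lemniscatic case is a Beta integral, by the substitution `u = (1 + x²)⁻²`. -/
lemma agmIntegral_sqrt_two_one :
    4 * agmIntegral (Real.sqrt 2) 1 = ProbabilityTheory.beta (1 / 4) (1 / 2) := by
  have himg : (fun x : ℝ => ((1 + x ^ 2) ^ 2)⁻¹) '' Set.Ioi 0 = Set.Ioo 0 1 := by
    ext u
    constructor
    · rintro ⟨x, hx, rfl⟩
      have hx' : 0 < x := hx
      refine ⟨by positivity, inv_lt_one_of_one_lt₀ ?_⟩
      nlinarith [sq_nonneg x, pow_pos hx' 2]
    · rintro ⟨h0, h1⟩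
      have hs0 : 0 < Real.sqrt u := Real.sqrt_pos.mpr h0
      have hs1 : Real.sqrt u < 1 := by
        rw [Real.sqrt_lt' one_pos]; linarith
      have hgt : 0 < (Real.sqrt u)⁻¹ - 1 := by
        linarith [(one_lt_inv₀ hs0).mpr hs1]
      refine ⟨Real.sqrt ((Real.sqrt u)⁻¹ - 1), Real.sqrt_pos.mpr hgt, ?_⟩
      simp only
      rw [Real.sq_sqrt hgt.le, add_sub_cancel, inv_pow, Real.sq_sqrt h0.le, inv_inv]
  have hderiv : ∀ x ∈ Set.Ioi (0 : ℝ), HasDerivWithinAt (fun x : ℝ => ((1 + x ^ 2) ^ 2)⁻¹)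
      (-(4 * x) / (1 + x ^ 2) ^ 3) (Set.Ioi 0) x := by
    intro x hx
    have hne : (1 + x ^ 2) ^ 2 ≠ 0 := by positivity
    have h := ((((hasDerivAt_pow 2 x).const_add 1).pow 2).inv hne)
    refine (h.congr_deriv ?_).hasDerivWithinAt
    simp only [Pi.pow_apply]
    field_simp
    ring
  have hinj : Set.InjOn (fun x : ℝ => ((1 + x ^ 2) ^ 2)⁻¹) (Set.Ioi 0) := by
    intro s hs t ht h
    have hs' : 0 < s := hs
    have ht' : 0 < t := ht
    have h1 := inv_injective h
    have h2 := (sq_eq_sq₀ (by positivity) (by positivity)).mp h1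
    exact (sq_eq_sq₀ hs'.le ht'.le).mp (by linarith)
  rw [beta_eq_setIntegral (by norm_num) (by norm_num), ← himg,
    MeasureTheory.integral_image_eq_integral_abs_deriv_smul measurableSet_Ioi hderiv hinj,
    agmIntegral, ← MeasureTheory.integral_const_mul]
  refine MeasureTheory.setIntegral_congr_fun measurableSet_Ioi fun x hx => ?_
  have hx' : 0 < x := hx
  have hy : 0 < 1 + x ^ 2 := by positivity
  have hw : 0 < x ^ 2 + 2 := by positivity
  have e1 : ((((1 + x ^ 2) ^ 2)⁻¹ : ℝ)) ^ (1 / 4 - 1 : ℝ) =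
      (1 + x ^ 2) * Real.sqrt (1 + x ^ 2) := by
    rw [Real.inv_rpow (by positivity), ← Real.rpow_neg (by positivity), ← Real.rpow_natCast,
      ← Real.rpow_mul hy.le, Real.sqrt_eq_rpow]
    nth_rewrite 2 [← Real.rpow_one (1 + x ^ 2)]
    rw [← Real.rpow_add hy]
    norm_num
  have e2 : ((1 - ((1 + x ^ 2) ^ 2)⁻¹ : ℝ)) ^ (1 / 2 - 1 : ℝ) =
      (1 + x ^ 2) / (x * Real.sqrt (x ^ 2 + 2)) := by
    rw [show (1 / 2 - 1 : ℝ) = -(1 / 2) by norm_num,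
      show 1 - ((1 + x ^ 2) ^ 2)⁻¹ = (x / (1 + x ^ 2)) ^ 2 * (x ^ 2 + 2) by field_simp; ring,
      Real.rpow_neg (by positivity), ← Real.sqrt_eq_rpow, Real.sqrt_mul (by positivity),
      Real.sqrt_sq (by positivity)]
    field_simp
  simp only [smul_eq_mul]
  rw [e1, e2, neg_div, abs_neg, abs_of_pos (by positivity), Real.sq_sqrt zero_le_two,
    one_pow, Real.sqrt_mul hw.le, add_comm (x ^ 2) 1]
  have h3 := Real.sqrt_pos.mpr hw
  have h4 := Real.sqrt_pos.mpr hy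
  have h5 := Real.sq_sqrt hy.le
  field_simp
  rw [h5]

/-! ### The value of the theta function at the fixed point -/

lemma realTheta_pos {γ : ℝ} (hγ : 0 < γ) : 0 < realTheta γ :=
  one_pos.trans (one_lt_realTheta hγ)

lemma realThetaAlt_sq_le {γ : ℝ} (hγ : 0 < γ) : realThetaAlt γ ^ 2 ≤ realTheta γ ^ 2 :=
  sq_le_sq.mpr ((abs_realThetaAlt_le hγ).trans (le_abs_self _))

/-- The doubling identities say that `γ ↦ 2 γ` is one arithmetic-geometric mean step for the pair
`(ϑ₃², ϑ₄²)`. -/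
lemma agmIntegral_theta_double {γ : ℝ} (hγ : 0 < γ) (h : realThetaAlt γ ≠ 0) :
    agmIntegral (realTheta (2 * γ) ^ 2) (realThetaAlt (2 * γ) ^ 2) =
      agmIntegral (realTheta γ ^ 2) (realThetaAlt γ ^ 2) := by
  have h3 := realTheta_pos hγ
  rw [← agmIntegral_half_add_sqrt_mul (a := realTheta γ ^ 2) (b := realThetaAlt γ ^ 2)
      (by positivity) (by positivity),
    realTheta_sq_add_realThetaAlt_sq hγ, mul_div_cancel_left₀ _ two_ne_zero, ← mul_pow,
    realTheta_mul_realThetaAlt hγ, Real.sqrt_sq (sq_nonneg _)]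

/-- Along `γ, 2 γ, 4 γ, …` the integral is constant while both arguments tend to `1`, where the
elementary bounds of `agmIntegral_bounds` squeeze it to `π / 2`. -/
lemma agmIntegral_theta {γ : ℝ} (hγ : 0 < γ) (h : realThetaAlt γ ≠ 0) :
    agmIntegral (realTheta γ ^ 2) (realThetaAlt γ ^ 2) = Real.pi / 2 := by
  have hpos : ∀ n : ℕ, 0 < 2 ^ n * γ := fun n => by positivity
  have key : ∀ n : ℕ, realThetaAlt (2 ^ n * γ) ≠ 0 ∧
      agmIntegral (realTheta (2 ^ n * γ) ^ 2) (realThetaAlt (2 ^ n * γ) ^ 2) =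
        agmIntegral (realTheta γ ^ 2) (realThetaAlt γ ^ 2) := by
    intro n
    induction n with
    | zero => simpa using h
    | succ n ih =>
      rw [pow_succ', mul_assoc, agmIntegral_theta_double (hpos n) ih.1]
      refine ⟨fun h0 => ?_, ih.2⟩
      have := realTheta_mul_realThetaAlt (hpos n)
      rw [h0, zero_pow two_ne_zero] at this
      exact mul_ne_zero (realTheta_pos (hpos n)).ne' ih.1 this
  have hlim : Filter.Tendsto (fun n : ℕ => 2 ^ n * γ) Filter.atTop Filter.atTop :=
    (tendsto_pow_atTop_atTop_of_one_lt one_lt_two).atTop_mul_const hγ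
  have hbound : ∀ n : ℕ, _ := fun n => agmIntegral_bounds
    (pow_pos (abs_pos.mpr (key n).1) 2 |>.trans_eq (sq_abs _)) (realThetaAlt_sq_le (hpos n))
  have lim : ∀ f : ℝ → ℝ, Filter.Tendsto f Filter.atTop (nhds 1) →
      Filter.Tendsto (fun n : ℕ => Real.pi / (2 * f (2 ^ n * γ) ^ 2)) Filter.atTop
        (nhds (Real.pi / 2)) := by
    intro f hf
    have h1 := ((hf.comp hlim).pow 2).const_mul 2
    have h2 := (tendsto_const_nhds (x := Real.pi)).div h1 (by norm_num)
    rw [one_pow, mul_one] at h2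
    exact h2
  refine le_antisymm (ge_of_tendsto' (lim _ tendsto_realThetaAlt_atTop) fun n => ?_)
    (le_of_tendsto' (lim _ tendsto_realTheta_atTop) fun n => ?_)
  · rw [← (key n).2]; exact (hbound n).2
  · rw [← (key n).2]; exact (hbound n).1

/-- The lemniscatic Beta value, with `Γ(1/4)` removed by the reflection formula. -/
lemma beta_one_fourth_one_half :
    ProbabilityTheory.beta (1 / 4) (1 / 2) =
      Real.sqrt Real.pi * Real.pi * Real.sqrt 2 / Real.Gamma (3 / 4) ^ 2 := by
  have hG : 0 < Real.Gamma (3 / 4) := Real.Gamma_pos_of_pos (by norm_num)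
  have h := Real.Gamma_mul_Gamma_one_sub (1 / 4)
  rw [show (1 : ℝ) - 1 / 4 = 3 / 4 by norm_num, show Real.pi * (1 / 4) = Real.pi / 4 by ring,
    Real.sin_pi_div_four] at h
  have h2 : Real.Gamma (1 / 4) = Real.pi * Real.sqrt 2 / Real.Gamma (3 / 4) := by
    rw [eq_div_iff hG.ne', h]
    have := Real.sq_sqrt (zero_le_two (α := ℝ))
    field_simp
    linarith
  rw [ProbabilityTheory.beta, Real.Gamma_one_half_eq, h2,
    show (1 / 4 + 1 / 2 : ℝ) = 3 / 4 by norm_num]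
  field_simp

lemma realTheta_pi : realTheta Real.pi = Real.pi ^ ((1 : ℝ) / 4) / Real.Gamma (3 / 4) := by
  have hpi := Real.pi_pos
  have hG : 0 < Real.Gamma (3 / 4) := Real.Gamma_pos_of_pos (by norm_num)
  have hF := realTheta_pos hpi
  have h4 := realTheta_pi_pow_four
  have hs2 := Real.sq_sqrt (zero_le_two (α := ℝ))
  have hA : realThetaAlt Real.pi ≠ 0 := by
    intro h0
    rw [h0] at h4
    have := pow_pos hF 4
    norm_num at h4
    linarith
  have hsq : realTheta Real.pi ^ 2 = realThetaAlt Real.pi ^ 2 * Real.sqrt 2 := by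
    refine (pow_left_inj₀ (by positivity) (by positivity) two_ne_zero).mp ?_
    rw [mul_pow, hs2]
    linear_combination h4
  have hI := agmIntegral_theta hpi hA
  have hlem := agmIntegral_sqrt_two_one
  have hmul := agmIntegral_mul (k := realThetaAlt Real.pi ^ 2) (by positivity) (Real.sqrt 2) 1
  rw [mul_one, ← hsq, hI] at hmul
  rw [beta_one_fourth_one_half] at hlem
  have hF2 : realTheta Real.pi ^ 2 = Real.sqrt Real.pi / Real.Gamma (3 / 4) ^ 2 := by
    have hA2 : 0 < realThetaAlt Real.pi ^ 2 := by positivity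
    have h5 : 2 * Real.pi * realThetaAlt Real.pi ^ 2 =
        Real.sqrt Real.pi * Real.pi * Real.sqrt 2 / Real.Gamma (3 / 4) ^ 2 := by
      rw [← hlem]
      field_simp at hmul
      linarith
    rw [hsq]
    field_simp at h5 ⊢
    linear_combination (Real.sqrt 2 / 2) * h5 + (Real.sqrt Real.pi / 2) * hs2
  refine (pow_left_inj₀ hF.le (by positivity) two_ne_zero).mp ?_
  rw [hF2, div_pow, ← Real.rpow_natCast (Real.pi ^ ((1 : ℝ) / 4)), ← Real.rpow_mul hpi.le,
    Real.sqrt_eq_rpow]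
  norm_num

/-! ### The constant and the bounds -/

lemma thetaConstPi_eq : thetaConstPi = Real.exp Real.pi * (realTheta Real.pi - 1) := by
  rw [thetaConstPi, realTheta_pi]

lemma tsum_int_eq_of_even {f : ℤ → ℝ} (hf : Summable f) (heven : ∀ n, f (-n) = f n) :
    ∑' n : ℤ, f n = f 0 + 2 * ∑' n : ℕ, f ((n : ℤ) + 1) := by
  have hinj : Function.Injective fun n : ℕ => (n : ℤ) + 1 := fun a b h => by
    simpa using h
  have hs1 : Summable fun n : ℕ => f ((n : ℤ) + 1) := hf.comp_injective hinj
  have hs2 : Summable fun n : ℕ => f (-((n : ℤ) + 1)) := by simpa only [heven] using hs1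
  rw [tsum_of_add_one_of_neg_add_one hs1 hs2]
  simp only [heven]
  ring

/-- After multiplication by `e ^ π`, the terms with `|n| = 1` contribute `2`; the remaining terms
`2 e ^ (-π ((n + 1)² - 1))`, `n ≥ 1`, in which `(n + 1)² - 1 ≥ 3 n` and `π > 3`, are dominated by a geometric series of
ratio `e ^ (-9)`. -/
lemma thetaConstPi_lt : thetaConstPi < 2.002 := by
  have hpi := Real.pi_gt_three
  have hs := summable_exp_neg_mul_int_sq Real.pi_pos
  have hsplit : realTheta Real.pi =
      1 + 2 * ∑' n : ℕ, Real.exp (-Real.pi * ((n : ℝ) + 1) ^ 2) := by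
    have h := tsum_int_eq_of_even hs fun n => by rw [Int.cast_neg, neg_sq]
    rw [realTheta, h]
    push_cast
    rw [zero_pow two_ne_zero, mul_zero, Real.exp_zero]
  -- `2 / (1 - e ^ (-9)) < 2.002` amounts to `e ^ (-9) < 1 / 1001`.
  have hr : Real.exp (-9) < 1 / 1002 := by
    rw [Real.exp_neg, ← one_div, one_div_lt_one_div (Real.exp_pos _) (by norm_num)]
    calc (1002 : ℝ) < 2.7 ^ 9 := by norm_num
      _ < Real.exp 1 ^ 9 := by
        gcongr
        linarith [Real.exp_one_gt_d9]
      _ = Real.exp 9 := by rw [← Real.exp_nat_mul]; norm_num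
  have hr0 := Real.exp_pos (-9)
  have hle : ∀ n : ℕ, Real.exp Real.pi * Real.exp (-Real.pi * ((n : ℝ) + 1) ^ 2) ≤
      Real.exp (-9) ^ n := by
    intro n
    rw [← Real.exp_add, ← Real.exp_nat_mul]
    apply Real.exp_le_exp.mpr
    have h1 : (n : ℝ) ≤ (n : ℝ) ^ 2 := by exact_mod_cast Nat.le_self_pow two_ne_zero n
    have h0 : (0 : ℝ) ≤ n := n.cast_nonneg
    nlinarith [mul_nonneg (sub_nonneg.mpr hpi.le) h0, mul_nonneg Real.pi_pos.le (sub_nonneg.mpr h1)]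
  have hgeom := summable_geometric_of_lt_one hr0.le (by linarith)
  have hsum := (Summable.of_nonneg_of_le (fun n => by positivity) hle hgeom).tsum_le_tsum hle hgeom
  rw [tsum_mul_left, tsum_geometric_of_lt_one hr0.le (by linarith)] at hsum
  have hinv : (1 - Real.exp (-9))⁻¹ < 1.001 := by
    rw [inv_lt_comm₀ (by linarith) (by norm_num)]
    norm_num at hr ⊢
    linarith
  rw [thetaConstPi_eq, hsplit, add_sub_cancel_left]
  linarith

theorem mainTheorem6 :
    -- for `γ > 0` the series converges absolutely and its sum is the real number `theta3Zero γ`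
    (∀ γ : ℝ, 0 < γ →
      Summable (fun n : ℤ => ‖jacobiTheta3Term 0 ((Real.exp (-γ) : ℝ) : ℂ) n‖) ∧
      jacobiTheta3 0 ((Real.exp (-γ) : ℝ) : ℂ) = ((theta3Zero γ : ℝ) : ℂ)) ∧
    (∀ γ₀ γ : ℝ, 0 < γ₀ → γ₀ ≤ γ →
      theta3Zero γ - 1 ≤ Real.exp γ₀ * (theta3Zero γ₀ - 1) * Real.exp (-γ)) ∧
    (∀ γ : ℝ, Real.pi ≤ γ →
      theta3Zero γ - 1 ≤ thetaConstPi * Real.exp (-γ)) ∧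
    (∀ γ : ℝ, 0 < γ → γ ≤ Real.pi →
      Real.sqrt (Real.pi / γ) < theta3Zero γ ∧
      theta3Zero γ ≤
        Real.sqrt (Real.pi / γ) * (1 + thetaConstPi * Real.exp (-(Real.pi ^ 2 / γ)))) ∧
    thetaConstPi < 2.002 := by
  have hpi := Real.pi_pos
  simp only [theta3Zero_eq_realTheta]
  refine ⟨fun γ hγ => ⟨?_, jacobiTheta3_zero_exp γ⟩, fun γ₀ γ => realTheta_sub_one_le, ?_, ?_, ?_⟩
  · simp only [jacobiTheta3Term_zero_exp, Complex.norm_real]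
    exact (summable_exp_neg_mul_int_sq hγ).norm
  · intro γ hγ
    rw [thetaConstPi_eq]
    exact realTheta_sub_one_le hpi hγ
  · intro γ hγ hle
    have hs : 0 < Real.sqrt (Real.pi / γ) := Real.sqrt_pos.mpr (by positivity)
    -- The dual parameter `π² / γ` lies in the range `≥ π` of the preceding bound.
    have hdual : Real.pi ≤ Real.pi ^ 2 / γ := by
      rw [le_div_iff₀ hγ]
      nlinarith
    rw [realTheta_eq_sqrt_mul hγ, thetaConstPi_eq]
    refine ⟨lt_mul_of_one_lt_right hs (one_lt_realTheta (hpi.trans_le hdual)), ?_⟩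
    refine mul_le_mul_of_nonneg_left ?_ hs.le
    linarith [realTheta_sub_one_le hpi hdual]
  · exact thetaConstPi_lt
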